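/- **Theorem 3.1.** Let $G$ be a finite digraph (at most one directed edge $ij$ from a tail $i$ to a head $j$) with vertex set $V(G)$ and edge set $E(G)$, in which every vertex has positive outdegree. Let $K$ be a field, let $w_v$ $(v\in V(G))$ be indeterminates over $K$, and give each edge $uv\in E(G)$ the weight $w_{uv}(G)=w_v$; all identities below are in the rational function field $K(w_v : v\in V(G))$. Let $d_u=\sum_{uv\in E(G)}w_{uv}(G)$. For a weighted digraph $H$ and a vertex $x$ of $H$, let $t_x(H)=\sum_T\prod_{e\in E(T)}w_e(H)$, where $T$ runs over the oriented spanning trees of $H$ with root $x$, i.e. the subtrees of $H$ containing all vertices of $H$ in which $x$ has outdegree $0$ and every other vertex has outdegree $1$. A biclique is a bipartite digraph $Q$ whose vertices are partitioned into two nonempty parts $Q^{(1)},Q^{(2)}$ and whose edge set is $\{ij : i\in Q^{(1)},\ j\in Q^{(2)}\}$. Let $\varepsilon=\{Q_1,\ldots,Q_r\}$ be a biclique partition of $G$, i.e. a set of $r$ bicliques, all of whose edges are edges of $G$, such that each edge of $G$ belongs to exactly one of them. Put $w(Q_i)=\sum_{u\in Q_i^{(2)}}w_u$. Let $\Omega(\varepsilon)$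 be the weighted digraph with vertex set $\varepsilon$ and edge set $\{Q_iQ_j : Q_i^{(2)}\cap Q_j^{(1)}\neq\emptyset\}$, in which the edge $Q_iQ_j$ has weight $$w_{Q_iQ_j}(\Omega(\varepsilon))=w(Q_j)\sum_{u\in Q_i^{(2)}\cap Q_j^{(1)}}\frac{w_u}{d_u}.$$ (1) For every $u\in V(G)$, $$t_u(G)=\frac{w_u\prod_{v\in V(G),\,v\neq u}d_v}{\prod_{i=1}^r w(Q_i)}\sum_{Q_i:\,u\in Q_i^{(2)}}t_{Q_i}(\Omega(\varepsilon)).$$ (2) For every $Q_i\in\varepsilon$, $$t_{Q_i}(\Omega(\varepsilon))=\frac{\prod_{j=1}^r w(Q_j)}{\prod_{u\in V(G)}d_u}\sum_{u\in Q_i^{(1)}}t_u(G).$$ -/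

import Mathlib

/-- A weighted digraph on the vertex set `V`, with weights in `F`. There is at most one directed edge
from `i` (its tail) to `j` (its head). The value `weight i j` is meaningful only if `i j` is an
edge; everything below uses it only on edges. -/
structure WeightedDigraph (V F : Type*) extends Digraph V where
  /-- The weight of the edge from `i` to `j`. -/
  weight : V → V → F

namespace WeightedDigraph

variable {V F : Type*}

/-- The weights of `G` are induced by `w`: every edge `u v` has weight `w v`. -/
def WeightsInducedBy (G : WeightedDigraph V F) (w : V → F) : Prop :=
  ∀ u v, G.Adj u v → G.weight u v = w v

open Classical in
/-- The outdegree `d_u^+(G)`: the number of edges with tail `u`. -/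
noncomputable def outDegree [Fintype V] (G : WeightedDigraph V F) (u : V) : ℕ :=
  (Finset.univ.filter fun v => G.Adj u v).card

open Classical in
/-- The weighted degree `d_u(G)`: the sum of the weights of the edges with tail `u`. -/
noncomputable def weightedDegree [Fintype V] [AddCommMonoid F] (G : WeightedDigraph V F) (u : V) :
    F :=
  ∑ v ∈ Finset.univ.filter (fun v => G.Adj u v), G.weight u v

open Classical in
/-- `T` is the edge set of an oriented spanning tree of `G` with root `u`: `T` consists of edges
`(i, j)` of `G`, the underlying undirected graph on all the vertices of `G` is a tree, the root has
outdegree `0` in `T`, and every other vertex has outdegree `1` in `T`. (Forgetting directions neither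
hides a loop nor identifies two opposite edges here: `T` has one edge fewer than `G` has vertices,
which is what a tree on these vertices needs.) -/
def IsOrientedSpanningTree (G : WeightedDigraph V F) (u : V) (T : Finset (V × V)) : Prop :=
  (∀ e ∈ T, G.Adj e.1 e.2) ∧
  (SimpleGraph.fromRel fun i j => (i, j) ∈ T).IsTree ∧
  (T.filter fun e => e.1 = u).card = 0 ∧
  ∀ v, v ≠ u → (T.filter fun e => e.1 = v).card = 1

open Classical in
/-- The spanning tree enumerator `t_u(G)`: the sum, over the oriented spanning trees of `G` with
root `u`, of the product of the weights of their edges. -/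
noncomputable def treeEnumerator [Fintype V] [CommSemiring F] (G : WeightedDigraph V F) (u : V) :
    F :=
  ∑ T ∈ Finset.univ.filter (fun T : Finset (V × V) => G.IsOrientedSpanningTree u T),
    ∏ e ∈ T, G.weight e.1 e.2

end WeightedDigraph

/-- A biclique on vertices from `V`: a bipartite digraph whose vertices are partitioned into two
(nonempty, disjoint) parts, with exactly the edges `i j` for `i` in the first and `j` in the second
part. -/
structure Biclique (V : Type*) where
  /-- The first part `Q^{(1)}`, the tails of the edges. -/
  part1 : Finset V
  /-- The second part `Q^{(2)}`, the heads of the edges. -/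
  part2 : Finset V
  part1_nonempty : part1.Nonempty
  part2_nonempty : part2.Nonempty
  disjoint : Disjoint part1 part2

namespace Biclique

variable {V F : Type*}

/-- `i j` is an edge of the biclique `Q`. -/
def IsEdge (Q : Biclique V) (i j : V) : Prop := i ∈ Q.part1 ∧ j ∈ Q.part2

/-- `w(Q)`: the sum of `w u` over the vertices `u` in the second part of `Q`. -/
def weightSum [AddCommMonoid F] (w : V → F) (Q : Biclique V) : F := ∑ u ∈ Q.part2, w u

end Biclique

namespace WeightedDigraph

variable {V F : Type*}

/-- `ε` is a biclique partition of `G`: its members are bicliques in `G` (all their edges are edges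
of `G`), and each edge of `G` belongs to exactly one of them. -/
def IsBicliquePartition (G : WeightedDigraph V F) (ε : Finset (Biclique V)) : Prop :=
  (∀ Q ∈ ε, ∀ i j, Q.IsEdge i j → G.Adj i j) ∧
  ∀ i j, G.Adj i j → ∃! Q, Q ∈ ε ∧ Q.IsEdge i j

/-- The weighted biclique digraph `Ω(ε)` of a family `ε` of bicliques in `G`, for vertex weights `w`:
its vertices are the members of `ε`, there is an edge from `P` to `Q` iff the second part of `P`
meets the first part of `Q`, and this edge has the weight
`w(Q) * ∑ u ∈ P^{(2)} ∩ Q^{(1)}, w_u / d_u(G)`. -/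
noncomputable def bicliqueDigraph [Fintype V] [DecidableEq V] [Field F] (G : WeightedDigraph V F)
    (w : V → F) (ε : Finset (Biclique V)) : WeightedDigraph ε F where
  Adj P Q := (P.1.part2 ∩ Q.1.part1).Nonempty
  weight P Q := Q.1.weightSum w * ∑ u ∈ P.1.part2 ∩ Q.1.part1, w u / G.weightedDegree u

end WeightedDigraph

/-- The field of rational functions over `K` in the indeterminates `w_v`, `v ∈ V`. -/
abbrev VertexField (V K : Type*) [Field K] : Type _ := FractionRing (MvPolynomial V K)

/-- The indeterminate `w_v`, as an element of the field of rational functions. -/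
noncomputable def vertexIndeterminate (V K : Type*) [Field K] (v : V) : VertexField V K :=
  algebraMap (MvPolynomial V K) (VertexField V K) (MvPolynomial.X v)

/-! The partition factors the adjacency matrix of `G` as `B * C` (tail and head incidence). With `D`
the diagonal of the weighted degrees and `W` that of the `w(Q)`, the Laplacians are `D (1 - D⁻¹ B
C)` for `G` and `(1 - C D⁻¹ B) W` for `Ω(ε)`, so Sylvester's identity `det (1 + X Y) = det (1 + Y
X)` relates them. Both Laplacians are singular, so each is perturbed by a rank-one matrix `x yᵀ`
with `∑ y = 1`; by the matrix-tree theorem the determinant becomes `∑ x_u t_u`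
(`det_laplacianMatrix_add_vecMulVec`). The perturbations are chosen to preserve the Sylvester
pairing: perturbing `D⁻¹ B` gives (1), perturbing `C` gives (2). -/

/-! ### Rank-one perturbations of matrices with zero row sums. -/

open Matrix in
/-- Adding a rank-one matrix `x yᵀ` to a matrix with zero row sums: the determinant depends on `y`
only through the sum of its entries. -/
theorem Matrix.det_add_vecMulVec_of_mulVec_one_eq_zero {n F : Type*} [Fintype n] [DecidableEq n]
    [Field F] {L : Matrix n n F} (hL : L *ᵥ 1 = 0) (x y : n → F) (hy : ∑ i, y i = 1) (j : n) :
    (L + vecMulVec x y).det = (L.updateCol j x).det := by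
  have hdet : L.det = 0 := by
    refine Matrix.exists_mulVec_eq_zero_iff.mp ⟨1, ?_, hL⟩
    intro h
    simpa using congrFun h j
  -- `L` kills the all-ones vector, so the second factor alters only the rank-one term, turning
  -- `e_j` into `y`.
  have hfac : L + vecMulVec x y =
      (L + vecMulVec x (Pi.single j 1)) * (1 + vecMulVec 1 (y - Pi.single j 1)) := by
    rw [mul_add, mul_one, add_mul, mul_vecMulVec, hL, mul_vecMulVec, vecMulVec_mulVec]
    ext a b
    simp [vecMulVec_apply]
    ring
  have hunit : (1 + vecMulVec (1 : n → F) (y - Pi.single j 1)).det = 1 := by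
    rw [vecMulVec_eq Unit, det_one_add_replicateCol_mul_replicateRow]
    simp [dotProduct, hy]
  have hcol : L + vecMulVec x (Pi.single j 1) = L.updateCol j ((fun i => L i j) + x) := by
    ext a b
    by_cases hb : b = j
    · subst hb; simp [vecMulVec_apply]
    · simp [vecMulVec_apply, hb]
  rw [hfac, det_mul, hunit, mul_one, hcol, det_updateCol_add]
  have : L.updateCol j (fun i => L i j) = L := by
    ext a b
    by_cases hb : b = j
    · subst hb; simp
    · simp [hb]
  rw [this, hdet, zero_add]

open Matrix in
/-- For a matrix with zero row sums, the cofactors of a fixed row are all equal. -/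
theorem Matrix.det_updateRow_single_eq_of_mulVec_one_eq_zero {n F : Type*} [Fintype n]
    [DecidableEq n] [Field F] {L : Matrix n n F} (hL : L *ᵥ 1 = 0) (i j : n) :
    (L.updateRow j (Pi.single i 1)).det = (L.updateRow j (Pi.single j 1)).det := by
  -- The new row also sums to zero, so the all-ones vector stays in the kernel.
  have h : (L.updateRow j (Pi.single i 1 - Pi.single j 1)).det = 0 := by
    refine Matrix.exists_mulVec_eq_zero_iff.mp ⟨1, ?_, ?_⟩
    · intro h
      simpa using congrFun h j
    · ext a
      by_cases ha : a = j
      · subst ha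
        simp [mulVec, dotProduct]
      · have := congrFun hL a
        simpa [mulVec, dotProduct, ha] using this
  have h2 := det_updateRow_add L j (Pi.single i 1 - Pi.single j 1) (Pi.single j 1)
  rwa [sub_add_cancel, h, zero_add] at h2

-- Cramer's rule expands the determinant along column `j`, and each cofactor in row `u` may be moved
-- to the diagonal.
open Matrix in
theorem Matrix.det_add_vecMulVec_eq_sum_of_mulVec_one_eq_zero {n F : Type*} [Fintype n]
    [DecidableEq n] [Field F] {L : Matrix n n F} (hL : L *ᵥ 1 = 0) (x y : n → F)
    (hy : ∑ i, y i = 1) :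
    (L + vecMulVec x y).det = ∑ u, x u * (L.updateRow u (Pi.single u 1)).det := by
  obtain ⟨j⟩ : Nonempty n := by
    by_contra h
    rw [not_nonempty_iff] at h
    simp at hy
  rw [det_add_vecMulVec_of_mulVec_one_eq_zero hL x y hy j, ← cramer_apply, cramer_eq_adjugate_mulVec]
  simp only [mulVec, dotProduct, adjugate_apply]
  refine Finset.sum_congr rfl fun u _ => ?_
  rw [det_updateRow_single_eq_of_mulVec_one_eq_zero hL, mul_comm]

/-! ### Functional digraphs, trees and their determinants. -/

section RootedMaps

variable {V : Type*} {f : V → V} {r : V}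

/-- The edges `(v, f v)`, for `v` different from the root `r`, of the functional digraph of `f`. -/
def functionalEdges [Fintype V] [DecidableEq V] (f : V → V) (r : V) : Finset (V × V) :=
  (Finset.univ.erase r).image fun v => (v, f v)

theorem mem_functionalEdges [Fintype V] [DecidableEq V] {e : V × V} :
    e ∈ functionalEdges f r ↔ e.1 ≠ r ∧ e.2 = f e.1 := by
  obtain ⟨a, b⟩ := e
  simp only [functionalEdges, Finset.mem_image, Finset.mem_erase, Finset.mem_univ, and_true,
    Prod.mk.injEq]
  constructor
  · rintro ⟨v, hv, rfl, rfl⟩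
    exact ⟨hv, rfl⟩
  · rintro ⟨h, rfl⟩
    exact ⟨a, h, rfl, rfl⟩

/-- Iterating a map that fixes `r`, a point reaches `r` iff its image does. -/
theorem exists_iterate_apply_eq_iff (hr : f r = r) (v : V) :
    (∃ k, f^[k] (f v) = r) ↔ ∃ k, f^[k] v = r := by
  constructor
  · rintro ⟨k, hk⟩
    exact ⟨k + 1, by simpa using hk⟩
  · rintro ⟨k, hk⟩
    exact ⟨k, by rw [← Function.iterate_succ_apply, Function.iterate_succ_apply', hk, hr]⟩

theorem isTree_fromRel_functionalEdges_iff [Fintype V] [DecidableEq V] (hr : f r = r) :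
    (SimpleGraph.fromRel fun i j => (i, j) ∈ functionalEdges f r).IsTree ↔
      ∀ v, ∃ k, f^[k] v = r := by
  classical
  set H := SimpleGraph.fromRel fun i j => (i, j) ∈ functionalEdges f r with hH
  have hadj : ∀ a b, H.Adj a b ↔ a ≠ b ∧ ((a ≠ r ∧ b = f a) ∨ (b ≠ r ∧ a = f b)) := by
    intro a b
    simp [hH, SimpleGraph.fromRel_adj, mem_functionalEdges]
  constructor
  · intro h v
    -- Reaching `r` under iteration is invariant along edges, hence constant on connected
    -- components.
    have key : ∀ a b : V, H.Reachable a b → ((∃ k, f^[k] a = r) ↔ ∃ k, f^[k] b = r) := by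
      rintro a b ⟨p⟩
      induction p with
      | nil => rfl
      | cons hab _ ih =>
        refine Iff.trans ?_ ih
        rcases ((hadj _ _).mp hab).2 with ⟨_, rfl⟩ | ⟨_, rfl⟩
        · exact (exists_iterate_apply_eq_iff hr _).symm
        · exact exists_iterate_apply_eq_iff hr _
    exact (key v r (h.connected.preconnected v r)).mpr ⟨0, rfl⟩
  · intro h
    have hstep : ∀ v, H.Reachable v (f v) := by
      intro v
      by_cases hv : v = f v
      · rw [← hv]
      · refine SimpleGraph.Adj.reachable ((hadj _ _).mpr ⟨hv, Or.inl ⟨?_, rfl⟩⟩)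
        rintro rfl
        exact hv hr.symm
    have hiter : ∀ k v, H.Reachable v (f^[k] v) := by
      intro k
      induction k with
      | zero => intro v; exact SimpleGraph.Reachable.refl _
      | succ k ih => intro v; exact (hstep v).trans (ih (f v))
    have hto : ∀ v, H.Reachable v r := by
      intro v
      obtain ⟨k, hk⟩ := h v
      exact hk ▸ hiter k v
    have : Nonempty V := ⟨r⟩
    have hconn : H.Connected := ⟨fun a b => (hto a).trans (hto b).symm⟩
    refine SimpleGraph.isTree_iff_connected_and_card.mpr ⟨hconn, ?_⟩
    -- Each edge is some `s(v, f v)` with `v ≠ r`, so there are at most `|V| - 1` of them.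
    refine le_antisymm ?_ hconn.card_vert_le_card_edgeSet_add_one
    have hsub : H.edgeSet ⊆ ((Finset.univ.erase r).image fun v => s(v, f v) : Finset (Sym2 V)) := by
      intro e
      induction e with
      | h a b =>
        intro he
        rw [SimpleGraph.mem_edgeSet, hadj] at he
        simp only [Finset.coe_image, Set.mem_image, Finset.mem_coe, Finset.mem_erase,
          Finset.mem_univ, and_true]
        rcases he.2 with ⟨h1, rfl⟩ | ⟨h1, rfl⟩
        · exact ⟨a, h1, rfl⟩
        · exact ⟨b, h1, Sym2.eq_swap⟩
    have hcard := Set.ncard_le_ncard hsub (Finset.finite_toSet _)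
    rw [Set.ncard_coe_finset] at hcard
    have h2 : ((Finset.univ.erase r).image fun v => s(v, f v)).card ≤ Fintype.card V - 1 := by
      refine Finset.card_image_le.trans ?_
      simp [Finset.card_erase_of_mem]
    have h3 : 0 < Fintype.card V := Fintype.card_pos
    rw [Nat.card_coe_set_eq, Nat.card_eq_fintype_card]
    omega

open Matrix in
/-- The determinant of the Laplacian of a functional digraph, reduced at the root: it detects whether
all vertices reach the root. -/
theorem det_one_sub_functional [Fintype V] [DecidableEq V] {F : Type*} [Field F] (hr : f r = r)
    [Decidable (∀ v, ∃ k, f^[k] v = r)] :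
    (Matrix.of fun v => (Pi.single v 1 - if v = r then 0 else Pi.single (f v) 1 : V → F)).det =
      if ∀ v, ∃ k, f^[k] v = r then 1 else 0 := by
  classical
  split_ifs with h
  -- `d v` is the least number of steps from `v` to `r`. It drops along `f`, so the matrix is block
  -- triangular for `d`, with identity diagonal blocks.
  · choose d hd using fun v => (⟨Nat.find (h v), Nat.find_spec (h v), fun m => Nat.find_min' (h v)⟩ :
      ∃ k, f^[k] v = r ∧ ∀ m, f^[m] v = r → k ≤ m)
    have hlt : ∀ v, v ≠ r → d (f v) < d v := by
      intro v hv
      have h0 : d v ≠ 0 := by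
        intro h0
        have := (hd v).1
        rw [h0] at this
        exact hv this
      obtain ⟨k, hk⟩ := Nat.exists_eq_succ_of_ne_zero h0
      have h1 := (hd v).1
      rw [hk, Function.iterate_succ_apply] at h1
      have := (hd (f v)).2 k h1
      omega
    rw [Matrix.BlockTriangular.det (b := fun v => OrderDual.toDual (d v))]
    · refine Finset.prod_eq_one fun a _ => ?_
      refine Eq.trans (congrArg Matrix.det ?_) Matrix.det_one
      ext ⟨v, hv⟩ ⟨w, hw⟩
      have hne : v ≠ r → w ≠ f v := by
        rintro hvr rfl
        have h1 := hlt v hvr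
        have h2 : d v = d (f v) := OrderDual.toDual.injective (hv.trans hw.symm)
        omega
      by_cases hvr : v = r
      · simp [toSquareBlock_def, hvr, Matrix.one_apply, Pi.single_apply, eq_comm]
      · simp [toSquareBlock_def, hvr, Matrix.one_apply, Pi.single_apply, hne hvr, eq_comm (a := w)]
    · intro v w hvw
      replace hvw : d v < d w := hvw
      have hne : w ≠ v := by rintro rfl; omega
      by_cases hvr : v = r
      · simp [← hvr, hne]
      · have : w ≠ f v := by
          rintro rfl
          have := hlt v hvr
          omega
        simp [hvr, hne, this]
  -- The indicator of the vertices that never reach `r` is a nonzero kernel vector.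
  · refine Matrix.exists_mulVec_eq_zero_iff.mp ⟨fun v => if ∃ k, f^[k] v = r then 0 else 1, ?_, ?_⟩
    · intro h0
      refine h fun v => ?_
      by_contra hv
      have := congrFun h0 v
      simp [hv] at this
    · ext v
      by_cases hv : v = r
      · have : ∃ k, f^[k] r = r := ⟨0, rfl⟩
        simp [mulVec, hv, this]
      · have := exists_iterate_apply_eq_iff hr v
        change (Pi.single v 1 - if v = r then 0 else Pi.single (f v) 1 : V → F) ⬝ᵥ _ = 0
        rw [if_neg hv, sub_dotProduct]
        simp [this]

end RootedMaps

/-! ### The matrix-tree theorem. -/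

namespace WeightedDigraph

variable {V F : Type*}

open Classical in
/-- The weighted adjacency matrix. -/
noncomputable def adjacencyMatrix [Zero F] (G : WeightedDigraph V F) : Matrix V V F :=
  Matrix.of fun u v => if G.Adj u v then G.weight u v else 0

/-- The Laplacian matrix: weighted degrees minus weighted adjacencies. -/
noncomputable def laplacianMatrix [Fintype V] [DecidableEq V] [Field F] (G : WeightedDigraph V F) :
    Matrix V V F :=
  Matrix.diagonal G.weightedDegree - G.adjacencyMatrix

theorem weightedDegree_eq_sum_adjacencyMatrix [Fintype V] [Field F] (G : WeightedDigraph V F)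
    (u : V) : G.weightedDegree u = ∑ v, G.adjacencyMatrix u v := by
  simp [weightedDegree, adjacencyMatrix, Finset.sum_filter]

open Matrix in
theorem laplacianMatrix_mulVec_one [Fintype V] [DecidableEq V] [Field F]
    (G : WeightedDigraph V F) : G.laplacianMatrix *ᵥ 1 = 0 := by
  ext u
  rw [laplacianMatrix, sub_mulVec, Pi.sub_apply, mulVec_diagonal,
    weightedDegree_eq_sum_adjacencyMatrix]
  simp [mulVec, dotProduct]

/-- The oriented spanning trees are the edge sets of the functional digraphs, along edges of `G`, in
which all vertices reach the root. -/
theorem isOrientedSpanningTree_iff [Fintype V] [DecidableEq V] (G : WeightedDigraph V F) (r : V)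
    (T : Finset (V × V)) :
    G.IsOrientedSpanningTree r T ↔ ∃ f : V → V, f r = r ∧ (∀ v, v ≠ r → G.Adj v (f v)) ∧
      (∀ v, ∃ k, f^[k] v = r) ∧ functionalEdges f r = T := by
  classical
  constructor
  · rintro ⟨hadj, htree, hroot, hout⟩
    have hex : ∀ v, ∃ w, (v = r → w = r) ∧ (v ≠ r → ∀ x, (v, x) ∈ T ↔ x = w) := by
      intro v
      by_cases hv : v = r
      · exact ⟨r, fun _ => rfl, fun h => absurd hv h⟩
      · obtain ⟨⟨a, w⟩, he⟩ := Finset.card_eq_one.mp (hout v hv)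
        have hmem : ∀ x, (v, x) ∈ T ↔ v = a ∧ x = w := by
          intro x
          have := Finset.ext_iff.mp he (v, x)
          simpa using this
        have ha : v = a := by
          have := Finset.ext_iff.mp he (a, w)
          simp only [Finset.mem_filter, Finset.mem_singleton, iff_true] at this
          exact this.2.symm
        refine ⟨w, fun h => absurd h hv, fun _ x => ?_⟩
        rw [hmem]
        simp [ha]
    choose f hf1 hf2 using hex
    have hT : functionalEdges f r = T := by
      ext ⟨a, b⟩
      rw [mem_functionalEdges]
      by_cases ha : a = r
      · simp only [ha, ne_eq, not_true_eq_false, false_and, false_iff]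
        intro hmem
        rw [Finset.card_eq_zero] at hroot
        rw [Finset.eq_empty_iff_forall_notMem] at hroot
        exact hroot (r, b) (by simp [hmem])
      · simp [ha, hf2 a ha]
    refine ⟨f, hf1 r rfl, fun v hv => hadj (v, f v) ((hf2 v hv _).mpr rfl), ?_, hT⟩
    rw [← isTree_fromRel_functionalEdges_iff (hf1 r rfl), hT]
    exact htree
  · rintro ⟨f, hr, hadj, hreach, rfl⟩
    refine ⟨?_, (isTree_fromRel_functionalEdges_iff hr).mpr hreach, ?_, ?_⟩
    · rintro ⟨a, b⟩ he
      obtain ⟨h1, h2⟩ := mem_functionalEdges.mp he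
      dsimp only at h1 h2
      exact h2 ▸ hadj a h1
    · rw [Finset.card_eq_zero, Finset.eq_empty_iff_forall_notMem]
      intro e he
      simp only [Finset.mem_filter] at he
      exact (mem_functionalEdges.mp he.1).1 he.2
    · intro v hv
      rw [Finset.card_eq_one]
      refine ⟨(v, f v), ?_⟩
      ext ⟨a, b⟩
      simp only [Finset.mem_filter, mem_functionalEdges, Finset.mem_singleton, Prod.mk.injEq]
      constructor
      · rintro ⟨⟨_, rfl⟩, rfl⟩
        exact ⟨rfl, rfl⟩
      · rintro ⟨rfl, rfl⟩
        exact ⟨⟨hv, rfl⟩, rfl⟩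

theorem functionalEdges_injOn [Fintype V] [DecidableEq V] (r : V) :
    Set.InjOn (fun f : V → V => functionalEdges f r) {f | f r = r} := by
  intro f hf g hg hfg
  funext v
  by_cases hv : v = r
  · subst hv
    exact Eq.trans hf (Eq.symm hg)
  · have : (v, f v) ∈ functionalEdges g r := by
      rw [← show functionalEdges f r = functionalEdges g r from hfg, mem_functionalEdges]
      exact ⟨hv, rfl⟩
    exact (mem_functionalEdges.mp this).2

-- Maps that leave the edges of `G` contribute zero, so adjacency need not be imposed on them;
-- fixing `f r = r` makes a map recoverable from its tree.
open Classical in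
theorem treeEnumerator_eq_sum_maps [Fintype V] [DecidableEq V] [Field F] (G : WeightedDigraph V F)
    (r : V) :
    G.treeEnumerator r = ∑ f : V → V with f r = r ∧ ∀ v, ∃ k, f^[k] v = r,
      ∏ v ∈ Finset.univ.erase r, G.adjacencyMatrix v (f v) := by
  have hprod : ∀ f : V → V, (∏ v ∈ Finset.univ.erase r, G.adjacencyMatrix v (f v)) =
      if ∀ v, v ≠ r → G.Adj v (f v) then ∏ e ∈ functionalEdges f r, G.weight e.1 e.2 else 0 := by
    intro f
    split_ifs with h
    · rw [functionalEdges, Finset.prod_image]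
      · refine Finset.prod_congr rfl fun v hv => ?_
        simp [adjacencyMatrix, h v (Finset.ne_of_mem_erase hv)]
      · intro a _ b _ hab
        exact congrArg Prod.fst hab
    · push Not at h
      obtain ⟨v, hv, hadj⟩ := h
      exact Finset.prod_eq_zero (i := v) (by simp [hv]) (by simp [adjacencyMatrix, hadj])
  simp only [hprod]
  rw [← Finset.sum_filter, Finset.filter_filter, treeEnumerator]
  symm
  refine Finset.sum_bij (fun f _ => functionalEdges f r) ?_ ?_ ?_ ?_
  · intro f hf
    simp only [Finset.mem_filter, Finset.mem_univ, true_and] at hf ⊢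
    exact (G.isOrientedSpanningTree_iff r _).mpr ⟨f, hf.1.1, hf.2, hf.1.2, rfl⟩
  · intro f hf g hg hfg
    simp only [Finset.mem_filter, Finset.mem_univ, true_and] at hf hg
    exact functionalEdges_injOn r hf.1.1 hg.1.1 hfg
  · intro T hT
    simp only [Finset.mem_filter, Finset.mem_univ, true_and] at hT
    obtain ⟨f, h1, h2, h3, h4⟩ := (G.isOrientedSpanningTree_iff r _).mp hT
    exact ⟨f, by simpa using ⟨⟨h1, h3⟩, h2⟩, h4⟩
  · intro f _
    rfl

open Matrix in
/-- The **matrix-tree theorem** for weighted digraphs. -/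
theorem det_laplacianMatrix_updateRow [Fintype V] [DecidableEq V] [Field F]
    (G : WeightedDigraph V F) (r : V) :
    (G.laplacianMatrix.updateRow r (Pi.single r 1)).det = G.treeEnumerator r := by
  classical
  -- Each row is a combination of the rows `e_v - e_w`, to be expanded multilinearly over maps `f`.
  -- In row `r` only `w = r` has a nonzero coefficient, which forces `f r = r`.
  let c : V → V → F := fun v w =>
    if v = r then (if w = r then 1 else 0) else G.adjacencyMatrix v w
  let b : V → V → V → F := fun v w => Pi.single v 1 - if v = r then 0 else Pi.single w 1
  have hrows : G.laplacianMatrix.updateRow r (Pi.single r 1) = fun v => ∑ w, c v w • b v w := by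
    ext v x
    by_cases hv : v = r
    · subst hv
      simp [c, b, Finset.sum_apply, ite_smul, ite_apply]
    · rw [updateRow_ne hv]
      simp only [laplacianMatrix, weightedDegree_eq_sum_adjacencyMatrix, Matrix.sub_apply,
        diagonal_apply, c, b, hv, if_false, Finset.sum_apply, Pi.smul_apply, Pi.sub_apply,
        Pi.single_apply, smul_eq_mul, mul_sub, Finset.sum_sub_distrib, eq_comm (a := x)]
      simp
  have hexp : (G.laplacianMatrix.updateRow r (Pi.single r 1)).det =
      ∑ f : V → V, (∏ v, c v (f v)) * (Matrix.of fun v => b v (f v)).det := by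
    rw [hrows]
    refine ((detRowAlternating (R := F) (n := V)).toMultilinearMap.map_sum
      (fun v w => c v w • b v w)).trans ?_
    refine Finset.sum_congr rfl fun f _ => ?_
    exact (detRowAlternating (R := F) (n := V)).toMultilinearMap.map_smul_univ
      (fun v => c v (f v)) (fun v => b v (f v))
  rw [hexp, treeEnumerator_eq_sum_maps, Finset.sum_filter]
  refine Finset.sum_congr rfl fun f _ => ?_
  rw [← Finset.mul_prod_erase Finset.univ _ (Finset.mem_univ r)]
  have hc : ∏ v ∈ Finset.univ.erase r, c v (f v) =
      ∏ v ∈ Finset.univ.erase r, G.adjacencyMatrix v (f v) :=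
    Finset.prod_congr rfl fun v hv => by simp [c, Finset.ne_of_mem_erase hv]
  rw [hc]
  by_cases hr : f r = r
  · rw [show (Matrix.of fun v => b v (f v)).det = _ from det_one_sub_functional hr]
    simp only [c, hr, if_true, one_mul, true_and, mul_ite, mul_one, mul_zero]
  · simp [c, hr]

open Matrix in
/-- The matrix-tree theorem in the form of a rank-one perturbation of the Laplacian. -/
theorem det_laplacianMatrix_add_vecMulVec [Fintype V] [DecidableEq V] [Field F]
    (G : WeightedDigraph V F) (x y : V → F) (hy : ∑ i, y i = 1) :
    (G.laplacianMatrix + vecMulVec x y).det = ∑ u, x u * G.treeEnumerator u := by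
  simp_rw [det_add_vecMulVec_eq_sum_of_mulVec_one_eq_zero G.laplacianMatrix_mulVec_one x y hy,
    det_laplacianMatrix_updateRow]

/-! ### Incidence factorizations and the comparison of the two digraphs. -/

section BicliquePartition

variable (ε : Finset (Biclique V)) (w : V → F)

/-- The incidence matrix of vertices and the first parts of bicliques. -/
def tailIncidence [DecidableEq V] [Field F] : Matrix V ε F :=
  Matrix.of fun u Q => if u ∈ Q.1.part1 then 1 else 0

/-- The weighted incidence matrix of the second parts of bicliques and vertices. -/
def headIncidence [DecidableEq V] [Field F] : Matrix ε V F :=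
  Matrix.of fun Q v => if v ∈ Q.1.part2 then w v else 0

variable {ε w}

-- Entry `(u, v)` of the product sums over the bicliques containing the edge `u v`: exactly one for
-- an edge of `G`, none otherwise.
open Matrix in
theorem IsBicliquePartition.adjacencyMatrix_eq [DecidableEq V] [Field F]
    {G : WeightedDigraph V F} (hG : G.WeightsInducedBy w) (hε : G.IsBicliquePartition ε) :
    G.adjacencyMatrix = (tailIncidence ε : Matrix V ε F) * headIncidence ε w := by
  ext u v
  simp only [adjacencyMatrix, of_apply, mul_apply, tailIncidence, headIncidence]
  split_ifs with h
  · obtain ⟨Q, ⟨hQ, hQ1, hQ2⟩, huniq⟩ := hε.2 u v h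
    rw [Finset.sum_eq_single ⟨Q, hQ⟩]
    · simp [hQ1, hQ2, hG u v h]
    · rintro ⟨P, hP⟩ _ hne
      by_cases h1 : u ∈ P.part1
      · by_cases h2 : v ∈ P.part2
        · exact absurd (Subtype.ext (huniq P ⟨hP, h1, h2⟩)) hne
        · simp [h2]
      · simp [h1]
    · simp
  · symm
    refine Finset.sum_eq_zero fun P _ => ?_
    by_cases h1 : u ∈ P.1.part1
    · by_cases h2 : v ∈ P.1.part2
      · exact absurd (hε.1 P.1 P.2 u v ⟨h1, h2⟩) h
      · simp [h2]
    · simp [h1]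

open Matrix in
theorem headIncidence_mulVec_one [Fintype V] [DecidableEq V] [Field F] :
    headIncidence ε w *ᵥ 1 = fun Q => Q.1.weightSum w := by
  ext Q
  simp [headIncidence, mulVec, dotProduct, Biclique.weightSum]

open Matrix in
theorem IsBicliquePartition.tailIncidence_mulVec_weightSum [Fintype V] [DecidableEq V] [Field F]
    {G : WeightedDigraph V F} (hG : G.WeightsInducedBy w) (hε : G.IsBicliquePartition ε) :
    ((tailIncidence ε : Matrix V ε F) *ᵥ fun Q => Q.1.weightSum w) = G.weightedDegree := by
  rw [← headIncidence_mulVec_one, mulVec_mulVec, ← hε.adjacencyMatrix_eq hG]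
  ext u
  simp [weightedDegree_eq_sum_adjacencyMatrix, mulVec, dotProduct]

open Matrix in
theorem adjacencyMatrix_bicliqueDigraph [Fintype V] [DecidableEq V]
    [DecidableEq (Biclique V)] [Field F]
    (G : WeightedDigraph V F) :
    (G.bicliqueDigraph w ε).adjacencyMatrix =
      headIncidence ε w * diagonal (fun u => (G.weightedDegree u)⁻¹) * (tailIncidence ε : Matrix V ε F) *
        diagonal fun Q => Q.1.weightSum w := by
  ext P Q
  rw [mul_diagonal, mul_apply]
  have hsum : ∑ u, (headIncidence ε w * diagonal fun u => (G.weightedDegree u)⁻¹) P u *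
      (tailIncidence ε : Matrix V ε F) u Q =
      ∑ u ∈ P.1.part2 ∩ Q.1.part1, w u / G.weightedDegree u := by
    rw [← Finset.sum_subset (Finset.subset_univ (P.1.part2 ∩ Q.1.part1))]
    · refine Finset.sum_congr rfl fun u hu => ?_
      rw [Finset.mem_inter] at hu
      simp [mul_diagonal, headIncidence, tailIncidence, hu.1, hu.2, div_eq_mul_inv]
    · intro u _ hu
      rw [Finset.mem_inter, not_and_or] at hu
      rcases hu with hu | hu <;> simp [mul_diagonal, headIncidence, tailIncidence, hu]
  rw [hsum, mul_comm]
  simp only [adjacencyMatrix, of_apply, bicliqueDigraph]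
  by_cases h : (P.1.part2 ∩ Q.1.part1).Nonempty
  · exact if_pos h
  · rw [Finset.not_nonempty_iff_eq_empty] at h
    simp [h]

-- Row sums of `C D⁻¹ B W`: `W` sends the all-ones vector to the `w(Q)`, `B` sends these to the
-- degrees, `D⁻¹` returns all ones, and `C` gives the `w(Q)` again.
open Matrix in
theorem IsBicliquePartition.weightedDegree_bicliqueDigraph [Fintype V] [DecidableEq V]
    [DecidableEq (Biclique V)] [Field F]
    {G : WeightedDigraph V F} (hG : G.WeightsInducedBy w) (hε : G.IsBicliquePartition ε)
    (hd : ∀ u, G.weightedDegree u ≠ 0) :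
    (G.bicliqueDigraph w ε).weightedDegree = fun Q => Q.1.weightSum w := by
  have h : (G.bicliqueDigraph w ε).weightedDegree =
      (G.bicliqueDigraph w ε).adjacencyMatrix *ᵥ 1 := by
    ext Q
    simp [weightedDegree_eq_sum_adjacencyMatrix, mulVec, dotProduct]
  have h1 : (diagonal fun Q : ε => Q.1.weightSum w) *ᵥ 1 = fun Q => Q.1.weightSum w := by
    ext Q
    simp [mulVec_diagonal]
  have h2 : (diagonal fun u => (G.weightedDegree u)⁻¹) *ᵥ G.weightedDegree = 1 := by
    ext u
    simp [mulVec_diagonal, hd u]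
  rw [h, adjacencyMatrix_bicliqueDigraph, ← mulVec_mulVec, h1, ← mulVec_mulVec,
    hε.tailIncidence_mulVec_weightSum hG, ← mulVec_mulVec, h2, headIncidence_mulVec_one]

open Matrix in
theorem IsBicliquePartition.sum_treeEnumerator_bicliqueDigraph [Fintype V] [DecidableEq V]
    [DecidableEq (Biclique V)] [Field F]
    {G : WeightedDigraph V F} (hG : G.WeightsInducedBy w) (hε : G.IsBicliquePartition ε)
    (hd : ∀ u, G.weightedDegree u ≠ 0) (hw : ∀ Q ∈ ε, Q.weightSum w ≠ 0) (hne : ε.Nonempty)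
    (u : V) :
    (∏ v, G.weightedDegree v) * (w u * ∑ Q : ε with u ∈ Q.1.part2,
        (G.bicliqueDigraph w ε).treeEnumerator Q) =
      (∏ Q ∈ ε, Q.weightSum w) * (G.weightedDegree u * G.treeEnumerator u) := by
  obtain ⟨P₀, hP₀⟩ := hne
  set B : Matrix V ε F := tailIncidence ε with hB
  set C : Matrix ε V F := headIncidence ε w with hC
  set D : Matrix V V F := diagonal G.weightedDegree with hD
  set D' : Matrix V V F := diagonal fun u => (G.weightedDegree u)⁻¹ with hD'
  set W : Matrix ε ε F := diagonal fun Q => Q.1.weightSum w with hW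
  set W' : Matrix ε ε F := diagonal fun Q => (Q.1.weightSum w)⁻¹ with hW'
  have hDD : D * D' = 1 := by
    simp [hD, hD', diagonal_mul_diagonal, hd]
  have hWW : W' * W = 1 := by
    have : ∀ Q : ε, Q.1.weightSum w ≠ 0 := fun Q => hw Q.1 Q.2
    simp [hW, hW', diagonal_mul_diagonal, this]
  -- Only `∑ z = 1` matters; a unit vector supplies it.
  set z : ε → F := Pi.single ⟨P₀, hP₀⟩ 1 with hz
  have hz1 : ∑ Q, z Q = 1 := by simp [hz]
  have hy1 : ∑ v, (z ᵥ* (W' * C)) v = 1 := by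
    have h1 : W' *ᵥ (fun Q => Q.1.weightSum w) = 1 := by
      ext Q
      simp [hW', mulVec_diagonal, hw Q.1 Q.2]
    have : ∑ v, (z ᵥ* (W' * C)) v = (z ᵥ* (W' * C)) ⬝ᵥ 1 := by simp [dotProduct]
    rw [this, ← dotProduct_mulVec, ← mulVec_mulVec, hC, headIncidence_mulVec_one, h1]
    simpa [dotProduct] using hz1
  set e : V → F := Pi.single u 1 with he
  -- With `X = e zᵀ W⁻¹ - D⁻¹ B`, the two perturbed Laplacians are `(1 + C X) W` and `D (1 + X C)`.
  have hΩ : (G.bicliqueDigraph w ε).laplacianMatrix + vecMulVec (C *ᵥ e) z =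
      (1 + C * (vecMulVec e z * W' - D' * B)) * W := by
    rw [laplacianMatrix, hε.weightedDegree_bicliqueDigraph hG hd, adjacencyMatrix_bicliqueDigraph,
      Matrix.add_mul, Matrix.one_mul, Matrix.mul_sub, Matrix.sub_mul, ← Matrix.mul_assoc C,
      Matrix.mul_assoc _ W' W, hWW, Matrix.mul_one,
      mul_vecMulVec, ← Matrix.mul_assoc C]
    abel
  have hGm : G.laplacianMatrix + vecMulVec (D *ᵥ e) (z ᵥ* (W' * C)) =
      D * (1 + (vecMulVec e z * W' - D' * B) * C) := by
    rw [laplacianMatrix, hε.adjacencyMatrix_eq hG, Matrix.mul_add, Matrix.mul_one, Matrix.sub_mul,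
      Matrix.mul_sub,
      ← Matrix.mul_assoc D (D' * B), ← Matrix.mul_assoc D D', hDD, Matrix.one_mul,
      Matrix.mul_assoc, vecMulVec_mul,
      mul_vecMulVec]
    abel
  have h1 := (G.bicliqueDigraph w ε).det_laplacianMatrix_add_vecMulVec (C *ᵥ e) z hz1
  have h2 := G.det_laplacianMatrix_add_vecMulVec (D *ᵥ e) _ hy1
  rw [hΩ, det_mul] at h1
  rw [hGm, det_mul, ← det_one_add_mul_comm] at h2
  have hs1 : ∑ Q, (C *ᵥ e) Q * (G.bicliqueDigraph w ε).treeEnumerator Q =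
      w u * ∑ Q : ε with u ∈ Q.1.part2, (G.bicliqueDigraph w ε).treeEnumerator Q := by
    rw [Finset.sum_filter, Finset.mul_sum]
    refine Finset.sum_congr rfl fun Q _ => ?_
    simp [hC, he, headIncidence]
  have hs2 : ∑ v, (D *ᵥ e) v * G.treeEnumerator v = G.weightedDegree u * G.treeEnumerator u := by
    rw [Finset.sum_eq_single u]
    · simp [hD, he, mulVec_diagonal]
    · intro v _ hv
      simp [hD, he, mulVec_diagonal, hv]
    · simp
  rw [hs1] at h1
  rw [hs2] at h2
  rw [← h1, ← h2, hD, hW, det_diagonal, det_diagonal,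
    Finset.prod_coe_sort ε fun Q => Q.weightSum w]
  ring

open Matrix in
theorem IsBicliquePartition.treeEnumerator_bicliqueDigraph [Fintype V] [DecidableEq V]
    [DecidableEq (Biclique V)] [Field F]
    {G : WeightedDigraph V F} (hG : G.WeightsInducedBy w) (hε : G.IsBicliquePartition ε)
    (hd : ∀ u, G.weightedDegree u ≠ 0) (P : ε) :
    (∏ u, G.weightedDegree u) * (G.bicliqueDigraph w ε).treeEnumerator P =
      (∏ Q ∈ ε, Q.weightSum w) * ∑ u ∈ P.1.part1, G.treeEnumerator u := by
  obtain ⟨a, ha⟩ := P.1.part1_nonempty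
  set B : Matrix V ε F := tailIncidence ε with hB
  set C : Matrix ε V F := headIncidence ε w with hC
  set D : Matrix V V F := diagonal G.weightedDegree with hD
  set D' : Matrix V V F := diagonal fun u => (G.weightedDegree u)⁻¹ with hD'
  set W : Matrix ε ε F := diagonal fun Q => Q.1.weightSum w with hW
  have hDD : D * D' = 1 := by
    simp [hD, hD', diagonal_mul_diagonal, hd]
  set y : V → F := Pi.single a 1 with hy
  have hy1 : ∑ v, y v = 1 := by simp [hy]
  have hz1 : ∑ Q, (y ᵥ* (D' * B * W)) Q = 1 := by
    have h1 : W *ᵥ 1 = fun Q => Q.1.weightSum w := by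
      ext Q
      simp [hW, mulVec_diagonal]
    have h2 : D' *ᵥ G.weightedDegree = 1 := by
      ext u
      simp [hD', mulVec_diagonal, hd u]
    have : ∑ Q, (y ᵥ* (D' * B * W)) Q = (y ᵥ* (D' * B * W)) ⬝ᵥ 1 := by simp [dotProduct]
    rw [this, ← dotProduct_mulVec, ← mulVec_mulVec, h1, ← mulVec_mulVec, hB,
      hε.tailIncidence_mulVec_weightSum hG, h2]
    simpa [dotProduct] using hy1
  set e : ε → F := Pi.single P 1 with he
  -- Now `C` is perturbed: with `Y = e yᵀ - C`, the two matrices are `(1 + Y D⁻¹ B) W` and `D (1 +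
  -- D⁻¹ B Y)`.
  have hΩ : (G.bicliqueDigraph w ε).laplacianMatrix + vecMulVec e (y ᵥ* (D' * B * W)) =
      (1 + (vecMulVec e y - C) * (D' * B)) * W := by
    rw [laplacianMatrix, hε.weightedDegree_bicliqueDigraph hG hd, adjacencyMatrix_bicliqueDigraph,
      Matrix.add_mul, Matrix.one_mul, Matrix.sub_mul, Matrix.sub_mul, ← Matrix.mul_assoc C,
      Matrix.mul_assoc _ (D' * B) W, vecMulVec_mul]
    abel
  have hGm : G.laplacianMatrix + vecMulVec (B *ᵥ e) y =
      D * (1 + (D' * B) * (vecMulVec e y - C)) := by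
    rw [laplacianMatrix, hε.adjacencyMatrix_eq hG, Matrix.mul_add, Matrix.mul_one,
      ← Matrix.mul_assoc D,
      ← Matrix.mul_assoc D D', hDD, Matrix.one_mul, Matrix.mul_sub, mul_vecMulVec]
    abel
  have h1 := (G.bicliqueDigraph w ε).det_laplacianMatrix_add_vecMulVec e _ hz1
  have h2 := G.det_laplacianMatrix_add_vecMulVec (B *ᵥ e) y hy1
  rw [hΩ, det_mul] at h1
  rw [hGm, det_mul, ← det_one_add_mul_comm] at h2
  have hs1 : ∑ Q, e Q * (G.bicliqueDigraph w ε).treeEnumerator Q =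
      (G.bicliqueDigraph w ε).treeEnumerator P := by
    simp [he, Pi.single_apply]
  have hs2 : ∑ v, (B *ᵥ e) v * G.treeEnumerator v = ∑ u ∈ P.1.part1, G.treeEnumerator u := by
    simp [hB, he, tailIncidence]
  rw [hs1] at h1
  rw [hs2] at h2
  rw [← h1, ← h2, hD, hW, det_diagonal, det_diagonal,
    Finset.prod_coe_sort ε fun Q => Q.weightSum w]
  ring

end BicliquePartition

end WeightedDigraph

/-! ### Nonvanishing of the denominators and conclusion. -/

theorem sum_vertexIndeterminate_ne_zero {V K : Type*} [Field K] {s : Finset V}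
    (hs : s.Nonempty) : ∑ v ∈ s, vertexIndeterminate V K v ≠ 0 := by
  classical
  obtain ⟨a, ha⟩ := hs
  simp only [vertexIndeterminate]
  rw [← map_sum]
  intro h
  have h0 : ∑ v ∈ s, (MvPolynomial.X v : MvPolynomial V K) = 0 :=
    (IsFractionRing.injective (MvPolynomial V K) (VertexField V K)) (by rw [h, map_zero])
  -- At the point with `w_a = 1` and all other coordinates zero, the sum takes the value 1.
  have h1 := congrArg (MvPolynomial.eval (Pi.single a (1 : K))) h0
  simp [Pi.single_apply, ha] at h1

theorem theorem3p1 {V : Type*} [Fintype V] [DecidableEq V] {K : Type*} [Field K]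
    (G : WeightedDigraph V (VertexField V K))
    (hG : G.WeightsInducedBy (vertexIndeterminate V K))
    (hdeg : ∀ u, 0 < G.outDegree u)
    (ε : Finset (Biclique V)) (hε : G.IsBicliquePartition ε) :
    (∀ u : V,
      G.treeEnumerator u =
        (vertexIndeterminate V K u * ∏ v ∈ Finset.univ.erase u, G.weightedDegree v) /
            (∏ Q ∈ ε, Q.weightSum (vertexIndeterminate V K)) *
          ∑ Q : ε with u ∈ Q.1.part2,
            (G.bicliqueDigraph (vertexIndeterminate V K) ε).treeEnumerator Q) ∧
    (∀ P : ε,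
      (G.bicliqueDigraph (vertexIndeterminate V K) ε).treeEnumerator P =
        (∏ Q ∈ ε, Q.weightSum (vertexIndeterminate V K)) / (∏ u, G.weightedDegree u) *
          ∑ u ∈ P.1.part1, G.treeEnumerator u) := by
  classical
  have hd : ∀ u, G.weightedDegree u ≠ 0 := by
    intro u
    have h : G.weightedDegree u = _ :=
      Finset.sum_congr rfl fun v hv => hG u v (Finset.mem_filter.mp hv).2
    rw [h]
    exact sum_vertexIndeterminate_ne_zero (Finset.card_pos.mp (hdeg u))
  have hw : ∀ Q ∈ ε, Q.weightSum (vertexIndeterminate V K) ≠ 0 := fun Q _ =>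
    sum_vertexIndeterminate_ne_zero Q.part2_nonempty
  have hdprod : ∏ v, G.weightedDegree v ≠ 0 := Finset.prod_ne_zero_iff.mpr fun u _ => hd u
  have hwprod : ∏ Q ∈ ε, Q.weightSum (vertexIndeterminate V K) ≠ 0 := Finset.prod_ne_zero_iff.mpr hw
  refine ⟨fun u => ?_, fun P => ?_⟩
  · have hne : ε.Nonempty := by
      obtain ⟨v, hv⟩ := Finset.card_pos.mp (hdeg u)
      obtain ⟨Q, ⟨hQ, _⟩, _⟩ := hε.2 u v (Finset.mem_filter.mp hv).2
      exact ⟨Q, hQ⟩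
    have h := hε.sum_treeEnumerator_bicliqueDigraph hG hd hw hne u
    rw [← Finset.mul_prod_erase Finset.univ _ (Finset.mem_univ u)] at h
    rw [div_mul_eq_mul_div, eq_div_iff hwprod]
    refine mul_left_cancel₀ (hd u) ?_
    linear_combination -h
  · rw [div_mul_eq_mul_div, eq_div_iff hdprod, mul_comm]
    exact hε.treeEnumerator_bicliqueDigraph hG hd P
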